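/- A unit-distance graph in the plane is a graph $G=(V,E)$ with $V\subseteq\mathbb{R}^2$ such that $\|v-w\|=1$ whenever $(v,w)\in E$. The chromatic number $\chi(\mathbb{R}^2)$ is the smallest number of colours in a colouring of all points of $\mathbb{R}^2$ in which any two points at distance $1$ receive different colours. A lattice is a set $\mathcal{L}=\{n_1v_1+n_2v_2 : n_1,n_2\in\mathbb{Z}\}$ with $v_1,v_2\in\mathbb{R}^2$ linearly independent. It is called rotatable if for all $0\le\alpha_1<\alpha_2\le\pi$ there are an angle $\alpha$ with $\alpha_1<\alpha<\alpha_2$ and a real number $\lambda>0$ such that $\lambda\,\rho_\alpha(\mathcal{L})\subseteq\mathcal{L}$, where $\rho_\alpha$ is the rotation by $\alpha$ around the point $(0,0)$. A unit-distance graph $G=(V,E)$ with a distinguished vertex $v_0\in V$ (its origin) is called lattice-like if there is a rotatable lattice containing $v_0$ and all neighbours of $v_0$ in $G$, and $v_0$ is not in the convex hull of its neighbours. For an integer $k\ge 0$, write $[k]=\{1,\dots,k\}$. A proper $k$-colouring of $G$ with bichromatic origin $v_0$ is a map $\varphi$ assigning to $v_0$ a two-element subset of $[k]$ and to every other vertex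 a one-element subset of $[k]$, such that $\varphi(v)\cap\varphi(w)=\emptyset$ whenever $(v,w)\in E$. Theorem. Let $k\ge 0$ be an integer. If there exists a lattice-like unit-distance graph $G=(V,E)$ with an origin $v_0$ that does not admit a proper $k$-colouring with bichromatic origin $v_0$, then $\chi(\mathbb{R}^2)\ge k+1$. -/

import Mathlib

/-- The Euclidean plane. -/
abbrev Plane : Type := EuclideanSpace ℝ (Fin 2)

/-- Rotation of the plane by the angle `α` (counterclockwise) around the point `(0, 0)`. -/
noncomputable def planeRotation (α : ℝ) (p : Plane) : Plane :=
  !₂[Real.cos α * p 0 - Real.sin α * p 1, Real.sin α * p 0 + Real.cos α * p 1]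

/-- The set of all integer combinations of `v₁` and `v₂`. -/
def latticeGen (v₁ v₂ : Plane) : Set Plane :=
  {p | ∃ n₁ n₂ : ℤ, p = (n₁ : ℝ) • v₁ + (n₂ : ℝ) • v₂}

/-- A planar lattice: generated over the integers by two linearly independent vectors. -/
def IsPlaneLattice (L : Set Plane) : Prop :=
  ∃ v₁ v₂ : Plane, LinearIndependent ℝ ![v₁, v₂] ∧ L = latticeGen v₁ v₂

/-- A lattice is rotatable if every nonempty open interval of angles inside `[0, π]` contains an
angle `α` such that some positive multiple of the image of `L` under rotation by `α` lies
in `L`. -/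
def IsRotatableLattice (L : Set Plane) : Prop :=
  IsPlaneLattice L ∧
    ∀ α₁ α₂ : ℝ, 0 ≤ α₁ → α₁ < α₂ → α₂ ≤ Real.pi →
      ∃ α : ℝ, α₁ < α ∧ α < α₂ ∧ ∃ c : ℝ, 0 < c ∧ ∀ p ∈ L, c • planeRotation α p ∈ L

/-- A graph drawn in the plane with unit-length edges, with origin `v₀`, is lattice-like if some
rotatable lattice contains `v₀` and all its neighbours, and `v₀` is not in the convex hull of its
neighbours. -/
def IsLatticeLike {V : Type*} {G : SimpleGraph V} (U : G.UnitDistEmbedding Plane) (v₀ : V) :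
    Prop :=
  (∃ L : Set Plane, IsRotatableLattice L ∧ U.p v₀ ∈ L ∧ ∀ v ∈ G.neighborSet v₀, U.p v ∈ L) ∧
    U.p v₀ ∉ convexHull ℝ (U.p '' G.neighborSet v₀)

/-- `φ` is a proper `k`-colouring of `G` with bichromatic origin `v₀`: the origin gets a set of two
colours, every other vertex gets a single colour, and adjacent vertices get disjoint sets. -/
def IsBichromaticOriginColoring {V : Type*} (G : SimpleGraph V) (v₀ : V) (k : ℕ)
    (φ : V → Finset (Fin k)) : Prop :=
  (φ v₀).card = 2 ∧ (∀ v, v ≠ v₀ → (φ v).card = 1) ∧ ∀ v w, G.Adj v w → Disjoint (φ v) (φ w)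

/-- The graph on all points of the plane in which two points are adjacent iff their distance
is `1`. Its chromatic number is the chromatic number of the plane. -/
def planeUnitDistanceGraph : SimpleGraph Plane where
  Adj p q := dist p q = 1
  symm := ⟨fun p q h => by rw [dist_comm]; exact h⟩
  loopless := ⟨fun p h => by simp at h⟩

/-! Suppose the plane, viewed as `ℂ`, has a proper `k`-colouring `f`. Giving the origin two colours
fails for every rotated copy of `G`, so around each `x` every rotation of the neighbour vectors `W`
shows all colours other than `f x` (`exists_neighbor_color`). Since `W` lies in an open half-plane,
it can be turned towards 0, so `f x` is determined by colours nearer 0. Rotatability lets finitely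
many rotations suffice, inside one discrete group `M`; hence a disc determines the colouring on `M`
(`eqOn_of_eqOn_disc`). Pigeonhole yields a period (`exists_period`), uniform over rotated copies of
`f`, so `f` is invariant under all translations of some length `r ≥ 1`. Two of these compose to a
unit translation, a contradiction (`not_rainbow`). -/

open scoped InnerProductSpace

/-! ### Rigidity and periodicity of colourings -/

section Rigidity

/-- Two colourings of an additive subgroup, one of which sees all the other colours around each
point, agree everywhere once they agree on a suitable disc. -/
theorem eqOn_of_eqOn_disc {κ : Type*} {M : AddSubgroup ℂ} {W Z : Set ℂ} {δ : ℝ} (hδ : 0 < δ)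
    (hW : ∀ w ∈ W, ‖w‖ = 1) (hZ : ∀ ρ ∈ Z, ‖ρ‖ = 1)
    (hM : ∀ ρ ∈ Z, ∀ w ∈ W, ρ * w ∈ M)
    (hdir : ∀ z : ℂ, ‖z‖ = 1 → ∃ ρ ∈ Z, ∀ w ∈ W, δ ≤ ⟪z, ρ * w⟫_ℝ)
    {f g : ℂ → κ}
    (hf : ∀ x, ∀ ρ ∈ Z, ∀ b, b ≠ f x → ∃ w ∈ W, f (x + ρ * w) = b)
    (hg : ∀ x y, ‖x - y‖ = 1 → g x ≠ g y)
    (h : ∀ x ∈ M, ‖x‖ ≤ 1 / δ → f x = g x) : ∀ x ∈ M, f x = g x := by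
  suffices H : ∀ n : ℕ, ∀ x ∈ M, ‖x‖ ^ 2 ≤ n → f x = g x by
    intro x hx
    obtain ⟨n, hn⟩ := exists_nat_ge (‖x‖ ^ 2)
    exact H n x hx hn
  intro n
  induction n with
  | zero =>
    intro x hx hn
    refine h x hx ?_
    have : ‖x‖ = 0 := by
      have h0 : ‖x‖ ^ 2 = 0 := le_antisymm (by simpa using hn) (sq_nonneg _)
      simpa using h0
    rw [this]; positivity
  | succ n ih =>
    intro x hx hn
    by_cases hxδ : ‖x‖ ≤ 1 / δ
    · exact h x hx hxδ
    push Not at hxδ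
    have hx0 : 0 < ‖x‖ := lt_trans (by positivity) hxδ
    -- Aim `W` from `x` towards 0. As `δ * ‖x‖ > 1`, the squared norm drops from `‖x‖ ^ 2` to at
    -- most `‖x‖ ^ 2 - 2 * δ * ‖x‖ + 1 < ‖x‖ ^ 2 - 1`, which drives the induction.
    obtain ⟨ρ, hρ, hin⟩ := hdir ((-‖x‖⁻¹ : ℝ) • x) (by
      rw [norm_smul, norm_neg, norm_inv, norm_norm, inv_mul_cancel₀ hx0.ne'])
    have key : ∀ w ∈ W, f (x + ρ * w) = g (x + ρ * w) := by
      intro w hw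
      refine ih _ (M.add_mem hx (hM ρ hρ w hw)) ?_
      have h1 := hin w hw
      rw [real_inner_smul_left] at h1
      have h2 : ⟪x, ρ * w⟫_ℝ ≤ -(δ * ‖x‖) := by
        have := mul_le_mul_of_nonneg_right h1 hx0.le
        have h3 : -‖x‖⁻¹ * ⟪x, ρ * w⟫_ℝ * ‖x‖ = -⟪x, ρ * w⟫_ℝ := by field_simp
        linarith
      have h4 : 1 < δ * ‖x‖ := by
        rw [div_lt_iff₀ hδ] at hxδ; linarith
      have h5 : ‖ρ * w‖ = 1 := by rw [norm_mul, hZ ρ hρ, hW w hw, one_mul]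
      rw [norm_add_sq_real, h5]
      push_cast at hn
      linarith
    by_contra hne
    obtain ⟨w, hw, hfw⟩ := hf x ρ hρ (g x) (Ne.symm hne)
    refine hg x (x + ρ * w) ?_ (by rw [← key w hw, hfw])
    rw [sub_add_cancel_left, norm_neg, norm_mul, hZ ρ hρ, hW w hw, one_mul]

/-- Rigid colourings are periodic, with a period depending only on the number of colourings of the
disc. -/
theorem exists_period {κ : Type*} [Finite κ] {M : AddSubgroup ℂ} {R : ℝ}
    (hfin : {x : ℂ | x ∈ M ∧ ‖x‖ ≤ R}.Finite) (F : Set (ℂ → κ))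
    (hshift : ∀ f ∈ F, ∀ t : ℂ, (fun x => f (x + t)) ∈ F)
    (hrigid : ∀ f ∈ F, ∀ g ∈ F, (∀ x ∈ M, ‖x‖ ≤ R → f x = g x) → ∀ x ∈ M, f x = g x) :
    ∃ m : ℕ, 0 < m ∧ ∀ f ∈ F, ∀ t ∈ M, f (m * t) = f 0 := by
  classical
  set B := {x : ℂ | x ∈ M ∧ ‖x‖ ≤ R}
  have : Finite B := hfin
  have : Fintype (B → κ) := Fintype.ofFinite _
  -- Pigeonhole gives a period at most the number of disc colourings, depending on `f` and `t`; the
  -- factorial is a multiple of all of these.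
  refine ⟨(Fintype.card (B → κ)).factorial, Nat.factorial_pos _, fun f hf t ht => ?_⟩
  obtain ⟨i, j, hij, hEq⟩ := Fintype.exists_ne_map_eq_of_card_lt
    (fun (n : Fin (Fintype.card (B → κ) + 1)) (x : B) => f (x + (n : ℕ) * t)) (by simp)
  wlog hlt : i < j generalizing i j
  · exact this j i hij.symm hEq.symm (lt_of_le_of_ne (not_lt.mp hlt) hij.symm)
  have hmul : ∀ n : ℕ, (n : ℂ) * t ∈ M := fun n => by
    rw [← nsmul_eq_mul]; exact M.nsmul_mem ht n
  have hagree : ∀ x ∈ M, f (x + (i : ℕ) * t) = f (x + (j : ℕ) * t) :=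
    hrigid _ (hshift f hf _) _ (hshift f hf _) fun x hx hxR => congrFun hEq ⟨x, hx, hxR⟩
  obtain ⟨d, hd⟩ := Nat.exists_eq_add_of_lt (Fin.lt_def.mp hlt)
  have hper : ∀ x ∈ M, f (x + ((d + 1 : ℕ) : ℂ) * t) = f x := by
    intro x hx
    have := hagree (x - (i : ℕ) * t) (M.sub_mem hx (hmul _))
    rw [sub_add_cancel, hd] at this
    rw [this]
    congr 1
    push_cast
    ring
  have hper' : ∀ n : ℕ, f (n * (((d + 1 : ℕ) : ℂ) * t)) = f 0 := by
    intro n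
    induction n with
    | zero => simp
    | succ n ih =>
      have hmem : (n : ℂ) * (((d + 1 : ℕ) : ℂ) * t) ∈ M := by
        rw [← mul_assoc, ← Nat.cast_mul]; exact hmul _
      rw [← ih, ← hper _ hmem]
      congr 1
      push_cast
      ring
  obtain ⟨q, hq⟩ := Nat.dvd_factorial (Nat.succ_pos d)
    (show d + 1 ≤ Fintype.card (B → κ) by have := j.isLt; omega)
  rw [hq, ← hper' q]
  congr 1
  push_cast
  ring

/-- A proper finite colouring of the plane cannot see all the other colours in every rotated
copy of `W` around every point. -/
theorem not_rainbow {κ : Type*} [Finite κ] {M : AddSubgroup ℂ} {W Z : Set ℂ} {δ : ℝ} (hδ : 0 < δ)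
    (hW : ∀ w ∈ W, ‖w‖ = 1) (hZ : ∀ ρ ∈ Z, ‖ρ‖ = 1)
    (hM : ∀ ρ ∈ Z, ∀ w ∈ W, ρ * w ∈ M)
    (hdir : ∀ z : ℂ, ‖z‖ = 1 → ∃ ρ ∈ Z, ∀ w ∈ W, δ ≤ ⟪z, ρ * w⟫_ℝ)
    (hfin : ∀ R : ℝ, {x : ℂ | x ∈ M ∧ ‖x‖ ≤ R}.Finite)
    {t : ℂ} (ht : t ∈ M) (ht1 : 1 ≤ ‖t‖) {f : ℂ → κ}
    (hf : ∀ x y, ‖x - y‖ = 1 → f x ≠ f y) :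
    ¬ ∀ x ρ, ‖ρ‖ = 1 → ∀ b, b ≠ f x → ∃ w ∈ W, f (x + ρ * w) = b := by
  intro hrain
  let F : Set (ℂ → κ) := {g | (∀ x y, ‖x - y‖ = 1 → g x ≠ g y) ∧
    ∀ x ρ, ‖ρ‖ = 1 → ∀ b, b ≠ g x → ∃ w ∈ W, g (x + ρ * w) = b}
  obtain ⟨m, hm, hper⟩ := exists_period (hfin (1 / δ)) F
    (fun g hg s => ⟨fun x y hxy => hg.1 _ _ (by simpa using hxy), fun x ρ hρ b hb => by
      simpa [add_right_comm] using hg.2 (x + s) ρ hρ b hb⟩)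
    (fun g hg g' hg' => eqOn_of_eqOn_disc hδ hW hZ hM hdir
      (fun x ρ hρ b hb => hg.2 x ρ (hZ ρ hρ) b hb) hg'.1)
  have hr : 1 ≤ ‖(m : ℂ) * t‖ := by
    rw [norm_mul, Complex.norm_natCast]
    exact one_le_mul_of_one_le_of_one_le (by exact_mod_cast hm) ht1
  set P := (m : ℂ) * t
  have hP : P ≠ 0 := by
    rw [← norm_pos_iff]; linarith
  have hstep : ∀ y v : ℂ, ‖v‖ = ‖P‖ → f (y + v) = f y := by
    intro y v hv
    -- The rotation about `y` taking direction `P` to `v` turns `f` into another member of `F`, with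
    -- the same `m`.
    have hρ : ‖v / P‖ = 1 := by rw [norm_div, hv, div_self (norm_ne_zero_iff.mpr hP)]
    have hmem : (fun x => f (y + v / P * x)) ∈ F := by
      refine ⟨fun x x' hx => hf _ _ ?_, fun x ρ h b hb => ?_⟩
      · rw [add_sub_add_left_eq_sub, ← mul_sub, norm_mul, hρ, hx, one_mul]
      · obtain ⟨w, hw, h⟩ := hrain (y + v / P * x) (v / P * ρ)
          (by rw [norm_mul, hρ, h, one_mul]) b hb
        exact ⟨w, hw, (congrArg f (by ring)).trans h⟩
    have := hper _ hmem t ht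
    change f (y + v / P * P) = f (y + v / P * 0) at this
    rwa [div_mul_cancel₀ _ hP, mul_zero, add_zero] at this
  -- The vectors `1/2 ± s * I` have length `‖P‖` and sum 1.
  let s := Real.sqrt (‖P‖ ^ 2 - 1 / 4)
  have hs : s ^ 2 = ‖P‖ ^ 2 - 1 / 4 := Real.sq_sqrt (by nlinarith)
  have hn : ∀ a : ℝ, a ^ 2 = s ^ 2 → ‖(⟨1 / 2, a⟩ : ℂ)‖ = ‖P‖ := by
    intro a ha
    rw [← sq_eq_sq₀ (norm_nonneg _) (norm_nonneg _), Complex.sq_norm, Complex.normSq_mk]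
    linarith
  have h1 := hstep 0 ⟨1 / 2, s⟩ (hn s rfl)
  have h2 := hstep (0 + ⟨1 / 2, s⟩) ⟨1 / 2, -s⟩ (hn (-s) (by ring))
  have h3 : (0 + ⟨1 / 2, s⟩ + ⟨1 / 2, -s⟩ : ℂ) = 1 := by
    apply Complex.ext <;> norm_num
  rw [h3, h1] at h2
  exact hf 1 0 (by simp) h2

end Rigidity

/-! ### Lattice multipliers and dense rotations -/

section Lattice

/-- A planar set generated over the integers by two linearly independent complex numbers meets
every disc in a finite set. -/
theorem finite_span_inter_disc {v : Fin 2 → ℂ} (hv : LinearIndependent ℝ v) (R : ℝ) :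
    {x : ℂ | x ∈ Submodule.span ℤ (Set.range v) ∧ ‖x‖ ≤ R}.Finite := by
  let b := basisOfLinearIndependentOfCardEqFinrank hv (by simp)
  have hb : ⇑b = v := coe_basisOfLinearIndependentOfCardEqFinrank hv _
  have := ZSpan.setFinite_inter b (s := Metric.closedBall 0 R) Metric.isBounded_closedBall
  rw [hb] at this
  refine this.subset fun x hx => ⟨?_, hx.1⟩
  simpa using hx.2

/-- The squared modulus of a multiplier of a planar lattice is an integer. -/
theorem exists_int_normSq_of_multiplier {v : Fin 2 → ℂ} (hv : LinearIndependent ℝ v) {z : ℂ}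
    (hz : ∀ p ∈ Submodule.span ℤ (Set.range v), z * p ∈ Submodule.span ℤ (Set.range v)) :
    ∃ q : ℤ, Complex.normSq z = q := by
  have hspan : ∀ p, p ∈ Submodule.span ℤ (Set.range v) →
      ∃ a b : ℤ, (a : ℂ) * v 0 + b * v 1 = p := by
    intro p hp
    rw [Submodule.mem_span_range_iff_exists_fun] at hp
    obtain ⟨c, hc⟩ := hp
    exact ⟨c 0, c 1, by simpa [Fin.sum_univ_two] using hc⟩
  obtain ⟨a, b, h0⟩ := hspan _ (hz _ (Submodule.subset_span ⟨0, rfl⟩))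
  obtain ⟨c, d, h1⟩ := hspan _ (hz _ (Submodule.subset_span ⟨1, rfl⟩))
  have hcross : (v 0).re * (v 1).im - (v 0).im * (v 1).re ≠ 0 := by
    intro h
    have hli := Fintype.linearIndependent_iff.mp hv
    have hre := hli ![(v 1).re, -(v 0).re] (by
      rw [Fin.sum_univ_two]
      apply Complex.ext <;> simp <;> linarith)
    have him := hli ![(v 1).im, -(v 0).im] (by
      rw [Fin.sum_univ_two]
      apply Complex.ext <;> simp <;> linarith)
    have : v 0 = 0 := Complex.ext (by simpa using hre 1) (by simpa using him 1)
    exact hv.ne_zero 0 this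
  -- Multiplication by `z` scales area by `normSq z`, which is thus its integer determinant in the
  -- lattice basis.
  refine ⟨a * d - b * c, mul_right_cancel₀ hcross ?_⟩
  have r0 := congrArg Complex.re h0
  have i0 := congrArg Complex.im h0
  have r1 := congrArg Complex.re h1
  have i1 := congrArg Complex.im h1
  simp at r0 i0 r1 i1
  rw [Complex.normSq_apply]
  push_cast
  have e : (z.re * z.re + z.im * z.im) * ((v 0).re * (v 1).im - (v 0).im * (v 1).re) =
      (z.re * (v 0).re - z.im * (v 0).im) * (z.re * (v 1).im + z.im * (v 1).re) -
      (z.re * (v 0).im + z.im * (v 0).re) * (z.re * (v 1).re - z.im * (v 1).im) := by ring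
  rw [e, ← r0, ← i0, ← r1, ← i1]
  ring

/-- Finitely many rotations, each mapping a subgroup into a fraction of itself, have a common
denominator. -/
theorem exists_common_denominator {L : AddSubgroup ℂ} {Z : Set ℂ} (hZ : Z.Finite)
    (h : ∀ ρ ∈ Z, ∃ q : ℕ, 0 < q ∧ ∀ p ∈ L, q * (ρ * p) ∈ L) :
    ∃ q : ℕ, 0 < q ∧ ∀ ρ ∈ Z, ∀ p ∈ L, q * (ρ * p) ∈ L := by
  choose! q hq hqL using h
  refine ⟨∏ ρ ∈ hZ.toFinset, q ρ, Finset.prod_pos fun ρ hρ => hq ρ (by simpa using hρ),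
    fun ρ hρ p hp => ?_⟩
  obtain ⟨r, hr⟩ := Finset.dvd_prod_of_mem q (hZ.mem_toFinset.mpr hρ)
  rw [hr, mul_comm (q ρ), Nat.cast_mul, mul_assoc, ← nsmul_eq_mul]
  exact L.nsmul_mem (hqL ρ hρ p hp) r

/-- The rotations mapping a rotatable lattice into a fraction of itself are dense. -/
theorem exists_rotation_near {v : Fin 2 → ℂ} (hv : LinearIndependent ℝ v)
    (hrot : ∀ α₁ α₂ : ℝ, 0 ≤ α₁ → α₁ < α₂ → α₂ ≤ Real.pi →
      ∃ α : ℝ, α₁ < α ∧ α < α₂ ∧ ∃ c : ℝ, 0 < c ∧ ∀ p ∈ Submodule.span ℤ (Set.range v),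
        c * (Complex.exp (α * Complex.I) * p) ∈ Submodule.span ℤ (Set.range v))
    {z : ℂ} (hz : ‖z‖ = 1) {ε : ℝ} (hε : 0 < ε) :
    ∃ ρ : ℂ, ‖ρ‖ = 1 ∧ ‖z - ρ‖ < ε ∧ ∃ q : ℕ, 0 < q ∧
      ∀ p ∈ Submodule.span ℤ (Set.range v), q * (ρ * p) ∈ Submodule.span ℤ (Set.range v) := by
  set θ := (-z).arg + Real.pi
  have hθ0 : 0 < θ := by have := Complex.neg_pi_lt_arg (-z); simp only [θ]; linarith
  have hθ1 : θ ≤ 2 * Real.pi := by have := Complex.arg_le_pi (-z); simp only [θ]; linarith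
  have hzθ : z = Complex.exp (θ * Complex.I) := by
    have h := Complex.norm_mul_exp_arg_mul_I (-z)
    rw [norm_neg, hz, Complex.ofReal_one, one_mul] at h
    simp only [θ]
    rw [Complex.ofReal_add, add_mul, Complex.exp_add, h, Complex.exp_pi_mul_I]
    ring
  -- Half the target angle: squaring the multiplier `c * exp (α * I)` doubles the angle and turns
  -- the scale into the integer `c ^ 2`.
  obtain ⟨α, hα1, hα2, c, hc, hcL⟩ := hrot (max 0 (θ / 2 - ε / 2)) (θ / 2) (le_max_left _ _)
    (max_lt (by linarith) (by linarith)) (by linarith)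
  have hα3 : θ / 2 - ε / 2 < α := lt_of_le_of_lt (le_max_right _ _) hα1
  obtain ⟨q, hq⟩ := exists_int_normSq_of_multiplier hv
    (z := c * Complex.exp (α * Complex.I)) (fun p hp => by rw [mul_assoc]; exact hcL p hp)
  have hcq : c ^ 2 = q := by
    rw [← hq, ← Complex.sq_norm, norm_mul, Complex.norm_exp_ofReal_mul_I, mul_one,
      Complex.norm_real, Real.norm_eq_abs, sq_abs]
  have hqpos : 0 < q := by
    have : (0 : ℝ) < q := by rw [← hcq]; positivity
    exact_mod_cast this
  refine ⟨Complex.exp ((2 * α : ℝ) * Complex.I), Complex.norm_exp_ofReal_mul_I _, ?_,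
    q.toNat, by omega, fun p hp => ?_⟩
  · have hfac : z - Complex.exp ((2 * α : ℝ) * Complex.I) =
        Complex.exp ((2 * α : ℝ) * Complex.I) *
          (Complex.exp (Complex.I * ((θ - 2 * α : ℝ) : ℂ)) - 1) := by
      rw [mul_sub, ← Complex.exp_add, hzθ]
      congr 2
      · push_cast; ring
      · ring
    rw [hfac, norm_mul, Complex.norm_exp_ofReal_mul_I, one_mul]
    refine (Real.norm_exp_I_mul_ofReal_sub_one_le).trans_lt ?_
    rw [Real.norm_eq_abs, abs_lt]
    constructor <;> linarith
  · have h2 := hcL _ (hcL p hp)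
    convert h2 using 1
    have hqc : ((q.toNat : ℕ) : ℂ) = (c : ℂ) ^ 2 := by
      rw [← Complex.ofReal_pow, hcq]
      rw [Complex.ofReal_intCast, ← Int.cast_natCast, Int.toNat_of_nonneg hqpos.le]
    have hexp : Complex.exp ((2 * α : ℝ) * Complex.I) =
        Complex.exp (α * Complex.I) * Complex.exp (α * Complex.I) := by
      rw [← Complex.exp_add]; congr 1; push_cast; ring
    rw [hqc, hexp]
    ring

/-- A finite set of lattice vectors of length one in an open half-plane cannot have all its
rotated translates see all the other colours of a proper finite colouring. -/
theorem not_rainbow_of_lattice {κ : Type*} [Finite κ] {v : Fin 2 → ℂ}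
    (hv : LinearIndependent ℝ v)
    (hrot : ∀ α₁ α₂ : ℝ, 0 ≤ α₁ → α₁ < α₂ → α₂ ≤ Real.pi →
      ∃ α : ℝ, α₁ < α ∧ α < α₂ ∧ ∃ c : ℝ, 0 < c ∧ ∀ p ∈ Submodule.span ℤ (Set.range v),
        c * (Complex.exp (α * Complex.I) * p) ∈ Submodule.span ℤ (Set.range v))
    {W : Set ℂ} (hW : ∀ w ∈ W, ‖w‖ = 1) (hWL : ∀ w ∈ W, w ∈ Submodule.span ℤ (Set.range v))
    {u : ℂ} (hu : ‖u‖ = 1) {δ : ℝ} (hδ : 0 < δ) (hWu : ∀ w ∈ W, δ ≤ ⟪u, w⟫_ℝ)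
    {f : ℂ → κ} (hf : ∀ x y, ‖x - y‖ = 1 → f x ≠ f y) :
    ¬ ∀ x ρ, ‖ρ‖ = 1 → ∀ b, b ≠ f x → ∃ w ∈ W, f (x + ρ * w) = b := by
  let L : AddSubgroup ℂ := (Submodule.span ℤ (Set.range v)).toAddSubgroup
  let A : Set ℂ := {ρ | ‖ρ‖ = 1 ∧ ∃ q : ℕ, 0 < q ∧ ∀ p ∈ L, q * (ρ * p) ∈ L}
  have hA : TotallyBounded A := (isCompact_sphere (0 : ℂ) 1).totallyBounded.subset
    fun ρ hρ => by simpa using hρ.1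
  -- Two errors of `δ / 4`, from density and from the finite net, leave `δ / 2` of the margin.
  obtain ⟨Z, hZA, hZfin, hZcov⟩ := Metric.finite_approx_of_totallyBounded hA (δ / 4) (by positivity)
  obtain ⟨q, hq, hqL⟩ := exists_common_denominator hZfin fun ρ hρ => (hZA hρ).2
  have hq0 : (q : ℂ) ≠ 0 := by exact_mod_cast hq.ne'
  let M : AddSubgroup ℂ := L.comap (AddMonoidHom.mulLeft (q : ℂ))
  have hMmem : ∀ x, x ∈ M ↔ (q : ℂ) * x ∈ L := fun x => Iff.rfl
  have hv0 : v 0 ∈ L := Submodule.subset_span ⟨0, rfl⟩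
  have hv0ne : 0 < ‖v 0‖ := norm_pos_iff.mpr (hv.ne_zero 0)
  obtain ⟨n, hn⟩ := exists_nat_ge (1 / ‖v 0‖)
  refine not_rainbow (M := M) (Z := Z) (δ := δ / 2) (t := n * v 0) (by positivity) hW
    (fun ρ hρ => (hZA hρ).1) (fun ρ hρ w hw => hqL ρ hρ w (hWL w hw)) ?_ ?_ ?_ ?_ hf
  · intro z hz
    have hu0 : u ≠ 0 := by rw [← norm_pos_iff, hu]; exact one_pos
    obtain ⟨ρ', hρ'1, hρ'2, hρ'3⟩ := exists_rotation_near hv hrot (z := z / u)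
      (by rw [norm_div, hz, hu, div_one]) (ε := δ / 4) (by positivity)
    obtain ⟨ρ, hρ, hρρ'⟩ := Set.mem_iUnion₂.mp (hZcov ⟨hρ'1, hρ'3⟩)
    rw [Metric.mem_ball, dist_eq_norm] at hρρ'
    refine ⟨ρ, hρ, fun w hw => ?_⟩
    have hρ1 := (hZA hρ).1
    have hnear : ‖z - ρ * u‖ ≤ δ / 2 := by
      have e : z - ρ * u = ((z / u - ρ') + (ρ' - ρ)) * u := by field_simp; ring
      rw [e, norm_mul, hu, mul_one]
      exact (norm_add_le _ _).trans (by linarith)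
    have e1 : ⟪z, ρ * w⟫_ℝ = ⟪z - ρ * u, ρ * w⟫_ℝ + ⟪ρ * u, ρ * w⟫_ℝ := by
      rw [← inner_add_left, sub_add_cancel]
    have e2 : ⟪ρ * u, ρ * w⟫_ℝ = ⟪u, w⟫_ℝ := by
      have hns : ρ.re * ρ.re + ρ.im * ρ.im = 1 := by
        rw [← Complex.normSq_apply, ← Complex.sq_norm, hρ1, one_pow]
      simp only [Complex.inner, Complex.mul_re, Complex.mul_im, Complex.conj_re, Complex.conj_im]
      linear_combination (u.re * w.re + u.im * w.im) * hns
    have e3 : |⟪z - ρ * u, ρ * w⟫_ℝ| ≤ δ / 2 := by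
      refine (abs_real_inner_le_norm _ _).trans ?_
      rw [norm_mul, hρ1, hW w hw, one_mul, mul_one]
      exact hnear
    have := neg_le_of_abs_le e3
    have := hWu w hw
    rw [e1, e2]
    linarith
  · intro R
    refine Set.Finite.of_finite_image (f := fun x => (q : ℂ) * x) ?_
      (mul_right_injective₀ hq0).injOn
    refine (finite_span_inter_disc hv (q * R)).subset ?_
    rintro _ ⟨x, ⟨hxM, hxR⟩, rfl⟩
    refine ⟨hxM, ?_⟩
    rw [norm_mul, Complex.norm_natCast]
    gcongr
  · rw [hMmem, ← mul_assoc, ← Nat.cast_mul, ← nsmul_eq_mul]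
    exact L.nsmul_mem hv0 _
  · rw [norm_mul, Complex.norm_natCast]
    rwa [div_le_iff₀ hv0ne] at hn

end Lattice

/-! ### Transfer to the complex line; colours and directions at the origin -/

section Plane

/-- The plane as the complex line. -/
noncomputable def planeToComplex : Plane ≃ₗᵢ[ℝ] ℂ := Complex.orthonormalBasisOneI.repr.symm

theorem planeToComplex_apply (p : Plane) : planeToComplex p = p 0 + p 1 * Complex.I := by
  have h := Complex.orthonormalBasisOneI.sum_repr_symm p
  rw [Fin.sum_univ_two] at h
  simp [planeToComplex, ← h]

theorem planeToComplex_planeRotation (α : ℝ) (p : Plane) :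
    planeToComplex (planeRotation α p) = Complex.exp (α * Complex.I) * planeToComplex p := by
  rw [planeToComplex_apply, planeToComplex_apply, Complex.exp_mul_I, ← Complex.ofReal_cos,
    ← Complex.ofReal_sin]
  apply Complex.ext <;> simp [planeRotation] <;> ring

theorem planeToComplex_mem_span_iff {v₁ v₂ p : Plane} :
    planeToComplex p ∈ Submodule.span ℤ (Set.range (planeToComplex ∘ ![v₁, v₂])) ↔
      p ∈ latticeGen v₁ v₂ := by
  rw [Submodule.mem_span_range_iff_exists_fun]
  constructor
  · rintro ⟨c, hc⟩
    refine ⟨c 0, c 1, planeToComplex.injective ?_⟩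
    rw [← hc]
    simp [Fin.sum_univ_two]
  · rintro ⟨a, b, rfl⟩
    exact ⟨![a, b], by simp [Fin.sum_univ_two]⟩

/-- If the graph has no proper colouring with bichromatic origin, then in every proper colouring of
the plane the neighbours of the origin of each rotated copy show all the other colours. -/
theorem exists_neighbor_color {V : Type*} {G : SimpleGraph V} (U : G.UnitDistEmbedding Plane)
    (v₀ : V) {k : ℕ} (hk : ¬ ∃ φ : V → Finset (Fin k), IsBichromaticOriginColoring G v₀ k φ)
    {f : ℂ → Fin k} (hf : ∀ x y, ‖x - y‖ = 1 → f x ≠ f y) (x ρ : ℂ) (hρ : ‖ρ‖ = 1)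
    (b : Fin k) (hb : b ≠ f x) :
    ∃ v ∈ G.neighborSet v₀,
      f (x + ρ * (planeToComplex (U.p v) - planeToComplex (U.p v₀))) = b := by
  classical
  by_contra hcon
  push Not at hcon
  let T : V → ℂ := fun v => x + ρ * (planeToComplex (U.p v) - planeToComplex (U.p v₀))
  have hT0 : T v₀ = x := by simp [T]
  have hT : ∀ v w, G.Adj v w → f (T v) ≠ f (T w) := by
    intro v w hvw
    refine hf _ _ ?_
    have : T v - T w = ρ * planeToComplex (U.p v - U.p w) := by
      simp only [T, map_sub]; ring
    rw [this, norm_mul, hρ, one_mul, LinearIsometryEquiv.norm_map, ← dist_eq_norm]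
    exact U.unit_dist hvw
  have hTb : ∀ v, G.Adj v₀ v → f (T v) ≠ b := fun v hv => hcon v hv
  -- If `b` is missing around `x`, it can be added at the origin.
  refine hk ⟨fun v => if v = v₀ then {f x, b} else {f (T v)}, ?_, ?_, ?_⟩
  · simp [Finset.card_pair hb.symm]
  · intro v hv
    simp [hv]
  · intro v w hvw
    have hne := hT v w hvw
    by_cases hv : v = v₀
    · subst hv
      have hw : w ≠ v := hvw.ne'
      have := hTb w hvw
      rw [hT0] at hne
      simp [hw, hne.symm, this]
    · by_cases hw : w = v₀
      · subst hw
        have := hTb v hvw.symm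
        rw [hT0] at hne
        simp [hv, hne, this]
      · simp [hv, hw, hne]

/-- A point outside the convex hull of a finite set sees it within an open half-plane. -/
theorem exists_direction {S : Set Plane} (hS : S.Finite) {p : Plane}
    (hp : p ∉ convexHull ℝ S) :
    ∃ u : ℂ, ‖u‖ = 1 ∧ ∃ δ : ℝ, 0 < δ ∧
      ∀ s ∈ S, δ ≤ ⟪u, planeToComplex s - planeToComplex p⟫_ℝ := by
  rcases S.eq_empty_or_nonempty with rfl | ⟨s₀, hs₀⟩
  · exact ⟨1, by simp, 1, one_pos, by simp⟩
  obtain ⟨g, a, hga, hgS⟩ := geometric_hahn_banach_point_closed (convex_convexHull ℝ S)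
    (hS.isClosed_convexHull ℝ) hp
  let y : Plane := (InnerProductSpace.toDual ℝ Plane).symm g
  have hy : ∀ s, ⟪y, s⟫_ℝ = g s := fun s => InnerProductSpace.toDual_symm_apply
  have hy0 : 0 < ‖y‖ := by
    rw [norm_pos_iff]
    intro h0
    have h1 := hy p
    have h2 := hy s₀
    have h3 := hgS s₀ (subset_convexHull ℝ S hs₀)
    rw [h0, inner_zero_left] at h1 h2
    linarith
  refine ⟨planeToComplex (‖y‖⁻¹ • y), ?_, ‖y‖⁻¹ * (a - g p),
    mul_pos (inv_pos.mpr hy0) (by linarith), fun s hs => ?_⟩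
  · rw [LinearIsometryEquiv.norm_map, norm_smul, norm_inv, norm_norm, inv_mul_cancel₀ hy0.ne']
  · rw [← map_sub, LinearIsometryEquiv.inner_map_map, real_inner_smul_left, inner_sub_right, hy, hy]
    have := hgS s (subset_convexHull ℝ S hs)
    gcongr

end Plane

theorem mainTheorem11 {V : Type*} (G : SimpleGraph V) (U : G.UnitDistEmbedding Plane) (v₀ : V)
    (hG : IsLatticeLike U v₀) (k : ℕ)
    (hk : ¬ ∃ φ : V → Finset (Fin k), IsBichromaticOriginColoring G v₀ k φ) :
    ((k + 1 : ℕ) : ℕ∞) ≤ planeUnitDistanceGraph.chromaticNumber := by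
  obtain ⟨⟨L, ⟨⟨v₁, v₂, hli, rfl⟩, hrot⟩, hv₀L, hnL⟩, hconv⟩ := hG
  by_contra hlt
  have hcol : planeUnitDistanceGraph.Colorable k := by
    rw [← SimpleGraph.chromaticNumber_le_iff_colorable]
    rw [not_le] at hlt
    exact Order.le_of_lt_add_one (by exact_mod_cast hlt)
  obtain ⟨C⟩ := hcol
  let e := planeToComplex
  let f : ℂ → Fin k := fun z => C (e.symm z)
  have hf : ∀ x y, ‖x - y‖ = 1 → f x ≠ f y := fun x y hxy => C.valid (by
    change dist (e.symm x) (e.symm y) = 1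
    rw [LinearIsometryEquiv.dist_map, dist_eq_norm, hxy])
  have hv : LinearIndependent ℝ (e ∘ ![v₁, v₂]) :=
    hli.map' e.toLinearEquiv.toLinearMap e.toLinearEquiv.ker
  let W : Set ℂ := (fun v => e (U.p v) - e (U.p v₀)) '' G.neighborSet v₀
  have hW : ∀ w ∈ W, ‖w‖ = 1 := by
    rintro _ ⟨v, hv, rfl⟩
    change ‖e (U.p v) - e (U.p v₀)‖ = 1
    rw [← map_sub, LinearIsometryEquiv.norm_map, ← dist_eq_norm, dist_comm]
    exact U.unit_dist hv
  have hWL : ∀ w ∈ W, w ∈ Submodule.span ℤ (Set.range (e ∘ ![v₁, v₂])) := by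
    rintro _ ⟨v, hv, rfl⟩
    exact Submodule.sub_mem _ (planeToComplex_mem_span_iff.mpr (hnL v hv))
      (planeToComplex_mem_span_iff.mpr hv₀L)
  -- Only finitely many lattice vectors have length 1, so `G` itself may be infinite.
  have hS : (U.p '' G.neighborSet v₀).Finite := by
    refine Set.Finite.of_finite_image (f := fun p => e p - e (U.p v₀)) ?_
      ((sub_left_injective.comp e.injective).injOn)
    rw [Set.image_image]
    exact (finite_span_inter_disc hv 1).subset fun w hw => ⟨hWL w hw, (hW w hw).le⟩
  obtain ⟨u, hu, δ, hδ, hδS⟩ := exists_direction hS hconv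
  refine not_rainbow_of_lattice hv ?_ hW hWL hu hδ ?_ hf ?_
  · intro α₁ α₂ h0 h1 h2
    obtain ⟨α, hα1, hα2, c, hc, hcL⟩ := hrot α₁ α₂ h0 h1 h2
    refine ⟨α, hα1, hα2, c, hc, fun z hz => ?_⟩
    obtain ⟨p, rfl⟩ := e.surjective z
    have := planeToComplex_mem_span_iff.mpr (hcL p (planeToComplex_mem_span_iff.mp hz))
    rwa [map_smul, planeToComplex_planeRotation, Complex.real_smul] at this
  · rintro _ ⟨v, hv, rfl⟩
    exact hδS _ ⟨v, hv, rfl⟩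
  · intro x ρ hρ b hb
    obtain ⟨v, hv, h⟩ := exists_neighbor_color U v₀ hk hf x ρ hρ b hb
    exact ⟨_, ⟨v, hv, rfl⟩, h⟩
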